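/- Let $d\ge 1$, $n=d+1$, $s\in(0,1)$ and $0<T\le\infty$. For $E\subset\mathbb R^{n}$ and $p\in\partial E$ put $$H_s(p,E)=\lim_{\delta\searrow 0}\,s(1-s)\int_{\mathbb R^{n}\setminus B_\delta(p)}\frac{\chi_{\mathbb R^{n}\setminus E}(q)-\chi_E(q)}{|p-q|^{n+s}}\,dq .$$ Let $u:\mathbb R^{d}\times[0,T)\to\mathbb R$ be continuous, of class $C^2$ on $\mathbb R^{d}\times(0,T)$, with $u(\cdot,0)$ of class $C^1$; let $E_t=\{(x,z)\in\mathbb R^d\times\mathbb R:\ z\le u(x,t)\}$, and suppose that $H_s(x,t):=H_s\big((x,u(x,t)),E_t\big)$ exists for all $x\in\mathbb R^d$ and $t\in[0,T)$. Put $v=\sqrt{1+|Du|^2}$. Assume that the graph evolves by fractional mean curvature, that is, $$\partial_t u=-\sqrt{1+|Du|^2}\;H_s\qquad\text{on }\mathbb R^{d}\times(0,T),$$ and that it has linear growth uniformly in time, that is, $\sup_{\mathbb R^d\times[0,T)}|Du|<\infty$. If $vH_s$ is bounded at the initial time, then $vH_s$ is bounded on $\mathbb R^d\times[0,T)$ by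 its initial bound: $$|v(x,t)\,H_s(x,t)|\le\sup_{y\in\mathbb R^d}|v(y,0)\,H_s(y,0)|\qquad\text{for all }x\in\mathbb R^d,\ t\in[0,T).$$ -/

import Mathlib

open MeasureTheory Filter Topology

noncomputable section

/-- `χ̃_E = χ_{Eᶜ} - χ_E`. -/
def signedIndicator {V : Type*} (E : Set V) (q : V) : ℝ :=
  Eᶜ.indicator 1 q - E.indicator 1 q

section Curvature

variable {V : Type*} [NormedAddCommGroup V] [InnerProductSpace ℝ V] [FiniteDimensional ℝ V]
  [MeasurableSpace V] [BorelSpace V]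

/-- `s (1 - s) ∫_{V ∖ B_δ(p)} χ̃_E(q) / |p - q|^{n + s} dq`, with `n = dim V`. -/
def truncatedFracMeanCurvature (s : ℝ) (E : Set V) (p : V) (δ : ℝ) : ℝ :=
  s * (1 - s) * ∫ q in (Metric.ball p δ)ᶜ,
    signedIndicator E q / ‖p - q‖ ^ ((Module.finrank ℝ V : ℝ) + s)

/-- The principal value that defines `H_s(p, E)` exists and equals `h`. -/
def HasFracMeanCurvature (s : ℝ) (E : Set V) (p : V) (h : ℝ) : Prop :=
  Tendsto (truncatedFracMeanCurvature s E p) (𝓝[>] 0) (𝓝 h)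

/-- The fractional mean curvature `H_s(p, E)`, the limit as `δ ↘ 0` of the truncated integrals;
it is meaningful only where `∃ h, HasFracMeanCurvature s E p h`. -/
def fracMeanCurvature (s : ℝ) (E : Set V) (p : V) : ℝ :=
  limUnder (𝓝[>] 0) (truncatedFracMeanCurvature s E p)

end Curvature

section Graph

variable {d : ℕ}

/-- `ℝ^d × ℝ` with the Euclidean structure of `ℝ^{d+1}`. -/
abbrev GraphSpace (d : ℕ) : Type := WithLp 2 (EuclideanSpace ℝ (Fin d) × ℝ)

/-- The set `{(x, z) : z ≤ f x}` below the graph of `f`. -/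
def subgraph (f : EuclideanSpace ℝ (Fin d) → ℝ) : Set (GraphSpace d) :=
  {q | q.snd ≤ f q.fst}

/-- The point `(x, f x)` of the graph of `f`. -/
def graphPoint (f : EuclideanSpace ℝ (Fin d) → ℝ) (x : EuclideanSpace ℝ (Fin d)) : GraphSpace d :=
  WithLp.toLp 2 (x, f x)

/-- `H_s` of the set below the graph of `f`, at the point of the graph over `x`. -/
def graphCurvature (s : ℝ) (f : EuclideanSpace ℝ (Fin d) → ℝ)
    (x : EuclideanSpace ℝ (Fin d)) : ℝ :=
  fracMeanCurvature s (subgraph f) (graphPoint f x)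

/-- `v = √(1 + |Df|²)`. -/
def areaFactor (f : EuclideanSpace ℝ (Fin d) → ℝ) (x : EuclideanSpace ℝ (Fin d)) : ℝ :=
  Real.sqrt (1 + ‖gradient f x‖ ^ 2)

/-- `u` is a classical solution on `[0, T)` (with `T = ∞` allowed) of the fractional mean
curvature flow of entire graphs, `∂ₜu = -√(1 + |Du|²) H_s`. The argument of `u` is `(t, x)`. -/
structure IsGraphicalFlow (s : ℝ) (T : EReal) (u : ℝ → EuclideanSpace ℝ (Fin d) → ℝ) : Prop where
  /-- `u` is continuous up to the initial time. -/
  continuousOn : ContinuousOn (fun q : ℝ × EuclideanSpace ℝ (Fin d) => u q.1 q.2)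
    {q | 0 ≤ q.1 ∧ (q.1 : EReal) < T}
  /-- `u` is of class `C²` in space and time at positive times. -/
  contDiffOn : ContDiffOn ℝ 2 (fun q : ℝ × EuclideanSpace ℝ (Fin d) => u q.1 q.2)
    {q | 0 < q.1 ∧ (q.1 : EReal) < T}
  /-- The initial surface is of class `C¹`. -/
  contDiff_zero : ContDiff ℝ 1 (u 0)
  /-- `H_s` is well defined at every point of the surface at every time, also at `t = 0`. -/
  hasCurvature : ∀ t : ℝ, 0 ≤ t → (t : EReal) < T → ∀ x,
    ∃ h, HasFracMeanCurvature s (subgraph (u t)) (graphPoint (u t) x) h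
  /-- The evolution equation. -/
  evolution : ∀ t : ℝ, 0 < t → (t : EReal) < T → ∀ x,
    HasDerivAt (fun τ => u τ x) (-(areaFactor (u t) x * graphCurvature s (u t) x)) t

end Graph

end

/-!
Two graphical flows that start at distance at most `m` stay at distance at most `m`. If
`v H_s ≤ M` initially, then the stationary graph `u₀` is a subsolution of the flow with constant
forcing `M`, so that comparison yields `u₀ - u(t) ≤ M t`. Comparison of `u` with its own time
translate then gives `u(t) - u(t + h) ≤ M h`, and dividing by `h` bounds `v H_s = -∂ₜu` from above
by `M`. The lower bound is the upper bound for `-u`, since `H_s` is odd under reflection.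

Comparison is proved by doubling the space variable, with the sum of a subsolution and the negative
of a supersolution. At a penalized maximum both graphs are touched from above by paraboloids of a
fixed opening, so that their curvatures near the contact points are bounded from below by a small
quantity, and away from these points one translated subgraph is contained in the other up to a set
of small measure for `|q|^{-(n+s)} dq`. The two gradients, hence the two area factors, agree up to
an error that vanishes with the penalty.
-/

open scoped RealInnerProductSpace Pointwise

section SignedIndicator

variable {V : Type*} {E F A : Set V} {q : V}

theorem signedIndicator_of_mem (hq : q ∈ E) : signedIndicator E q = -1 := by
  simp [signedIndicator, hq]

theorem signedIndicator_of_notMem (hq : q ∉ E) : signedIndicator E q = 1 := by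
  simp [signedIndicator, hq]

theorem abs_signedIndicator (E : Set V) (q : V) : |signedIndicator E q| = 1 := by
  by_cases hq : q ∈ E
  · simp [signedIndicator_of_mem hq]
  · simp [signedIndicator_of_notMem hq]

theorem signedIndicator_compl (E : Set V) (q : V) :
    signedIndicator Eᶜ q = -signedIndicator E q := by
  simp [signedIndicator]

theorem signedIndicator_preimage {W : Type*} (φ : W → V) (E : Set V) (w : W) :
    signedIndicator (φ ⁻¹' E) w = signedIndicator E (φ w) :=
  rfl

theorem signedIndicator_le_add_indicator_diff (E F : Set V) (q : V) :
    signedIndicator E q ≤ signedIndicator F q + (F \ E).indicator 2 q := by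
  by_cases hE : q ∈ E <;> by_cases hF : q ∈ F <;>
    norm_num [signedIndicator_of_mem, signedIndicator_of_notMem, hE, hF]

variable [MeasurableSpace V] {μ : Measure V} {k : V → ℝ}

theorem measurable_signedIndicator (hE : MeasurableSet E) : Measurable (signedIndicator E) :=
  (measurable_one.indicator hE.compl).sub (measurable_one.indicator hE)

theorem integrable_signedIndicator_mul (hE : MeasurableSet E) (hk : Integrable k μ) :
    Integrable (fun q => signedIndicator E q * k q) μ :=
  hk.bdd_mul (c := 1) (measurable_signedIndicator hE).aestronglyMeasurable
    (ae_of_all _ fun q => (abs_signedIndicator E q).le)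

theorem setIntegral_signedIndicator_mul_le (hE : MeasurableSet E) (hF : MeasurableSet F)
    (hk : IntegrableOn k A μ) (hk0 : ∀ q, 0 ≤ k q) :
    ∫ q in A, signedIndicator E q * k q ∂μ ≤
      ∫ q in A, signedIndicator F q * k q ∂μ + 2 * ∫ q in A ∩ (F \ E), k q ∂μ := by
  have hFE : MeasurableSet (F \ E) := hF.diff hE
  have hint : Integrable (fun q => 2 * (F \ E).indicator k q) (μ.restrict A) :=
    (hk.indicator hFE).const_mul 2
  rw [← setIntegral_indicator hFE, ← integral_const_mul,
    ← integral_add (integrable_signedIndicator_mul hF hk) hint]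
  refine integral_mono (integrable_signedIndicator_mul hE hk)
    ((integrable_signedIndicator_mul hF hk).add hint) fun q => ?_
  calc signedIndicator E q * k q
      ≤ (signedIndicator F q + (F \ E).indicator 2 q) * k q :=
        mul_le_mul_of_nonneg_right (signedIndicator_le_add_indicator_diff E F q) (hk0 q)
    _ = signedIndicator F q * k q + 2 * (F \ E).indicator k q := by
        by_cases hq : q ∈ F \ E <;> simp [hq, add_mul]

end SignedIndicator

section Kernel

variable {V : Type*} [NormedAddCommGroup V] [InnerProductSpace ℝ V]

/-- The kernel `1 / ‖q‖ ^ (n + s)`, with `n = dim V`, of the fractional mean curvature at the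
origin; at `q = 0` it takes the junk value `0`. -/
noncomputable def fracKernel (s : ℝ) (q : V) : ℝ := 1 / ‖q‖ ^ ((Module.finrank ℝ V : ℝ) + s)

theorem fracKernel_nonneg (s : ℝ) (q : V) : 0 ≤ fracKernel s q := by
  unfold fracKernel; positivity

variable {s r : ℝ}

theorem fracKernel_le_mul_one_add_norm_rpow_neg (hs : 0 < s) (hr : 0 < r) {q : V} (hq : r ≤ ‖q‖) :
    fracKernel s q ≤
      ((1 + r) / r) ^ (Module.finrank ℝ V + s) * (1 + ‖q‖) ^ (-(Module.finrank ℝ V + s)) := by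
  have hq0 : 0 < ‖q‖ := hr.trans_le hq
  have hle : 1 + ‖q‖ ≤ (1 + r) / r * ‖q‖ := by
    rw [div_mul_eq_mul_div, le_div_iff₀ hr]
    linarith
  rw [fracKernel, Real.rpow_neg (by positivity), ← div_eq_mul_inv,
    div_le_div_iff₀ (by positivity) (by positivity), one_mul,
    ← Real.mul_rpow (by positivity) hq0.le]
  exact Real.rpow_le_rpow (by positivity) hle (by positivity)

variable [MeasurableSpace V] [BorelSpace V]

theorem measurable_fracKernel (s : ℝ) : Measurable (fracKernel s : V → ℝ) := by
  unfold fracKernel; fun_prop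

variable [FiniteDimensional ℝ V]

theorem integrableOn_fracKernel_compl_ball (hs : 0 < s) (hr : 0 < r) :
    IntegrableOn (fracKernel s) (Metric.ball (0 : V) r)ᶜ := by
  refine Integrable.mono'
    ((integrable_one_add_norm (r := Module.finrank ℝ V + s) (by linarith)).const_mul
      (((1 + r) / r) ^ (Module.finrank ℝ V + s))).integrableOn
    (measurable_fracKernel s).aestronglyMeasurable ?_
  filter_upwards [ae_restrict_mem measurableSet_ball.compl] with q hq
  rw [Real.norm_of_nonneg (fracKernel_nonneg s q)]
  exact fracKernel_le_mul_one_add_norm_rpow_neg hs hr (by simpa using hq)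

theorem setIntegral_signedIndicator_preimage_isometry (s : ℝ) (φ : V ≃ₗᵢ[ℝ] V) (E : Set V)
    {A : Set V} (hA : φ ⁻¹' A = A) :
    ∫ q in A, signedIndicator (φ ⁻¹' E) q * fracKernel s q =
      ∫ q in A, signedIndicator E q * fracKernel s q := by
  have h := φ.measurePreserving.setIntegral_preimage_emb
    φ.toHomeomorph.toMeasurableEquiv.measurableEmbedding
    (fun q => signedIndicator E q * fracKernel s q) A
  simpa only [hA, fracKernel, φ.norm_map, signedIndicator_preimage] using h

/-- The reflection `q ↦ -q` exchanges `E` and `Eᶜ` outside `E ∩ -E` and a set that only helps. -/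
theorem neg_setIntegral_inter_neg_le {E A : Set V} (hE : MeasurableSet E) (hA : -A = A)
    (hk : IntegrableOn (fracKernel s) A) :
    -∫ q in A ∩ (E ∩ -E), fracKernel s q ≤ ∫ q in A, signedIndicator E q * fracKernel s q := by
  have hcompare := setIntegral_signedIndicator_mul_le hE.neg.compl hE hk (fracKernel_nonneg s)
  have hodd : ∫ q in A, signedIndicator (-E)ᶜ q * fracKernel s q =
      -∫ q in A, signedIndicator E q * fracKernel s q := by
    simp only [signedIndicator_compl, neg_mul, integral_neg]
    rw [← setIntegral_signedIndicator_preimage_isometry s (LinearIsometryEquiv.neg ℝ) E hA]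
    rfl
  rw [hodd, Set.sdiff_compl] at hcompare
  linarith

end Kernel

section TruncatedCurvature

variable {V : Type*} [NormedAddCommGroup V] [InnerProductSpace ℝ V] [FiniteDimensional ℝ V]
  [MeasurableSpace V] [BorelSpace V] {s δ r : ℝ} {E F : Set V}

theorem truncatedFracMeanCurvature_eq_preimage_add (s : ℝ) (E : Set V) (p : V) (δ : ℝ) :
    truncatedFracMeanCurvature s E p δ =
      truncatedFracMeanCurvature s ((p + ·) ⁻¹' E) 0 δ := by
  have h := (measurePreserving_add_left volume p).setIntegral_preimage_emb
    (MeasurableEquiv.addLeft p).measurableEmbedding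
    (fun q => signedIndicator E q / ‖p - q‖ ^ ((Module.finrank ℝ V : ℝ) + s)) (Metric.ball p δ)ᶜ
  have hball : (p + ·) ⁻¹' (Metric.ball p δ)ᶜ = (Metric.ball 0 δ)ᶜ := by
    ext w; simp
  rw [truncatedFracMeanCurvature, ← h, hball]
  simp only [truncatedFracMeanCurvature, sub_add_cancel_left, zero_sub, signedIndicator_preimage]

theorem truncatedFracMeanCurvature_zero (s : ℝ) (E : Set V) (δ : ℝ) :
    truncatedFracMeanCurvature s E 0 δ =
      s * (1 - s) * ∫ q in (Metric.ball 0 δ)ᶜ, signedIndicator E q * fracKernel s q := by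
  simp only [truncatedFracMeanCurvature, fracKernel, zero_sub, norm_neg, mul_one_div]

theorem truncatedFracMeanCurvature_compl (s : ℝ) (E : Set V) (p : V) (δ : ℝ) :
    truncatedFracMeanCurvature s Eᶜ p δ = -truncatedFracMeanCurvature s E p δ := by
  simp only [truncatedFracMeanCurvature, signedIndicator_compl, neg_div, integral_neg, mul_neg]

theorem truncatedFracMeanCurvature_zero_preimage_isometry (s : ℝ) (φ : V ≃ₗᵢ[ℝ] V) (E : Set V)
    (δ : ℝ) :
    truncatedFracMeanCurvature s (φ ⁻¹' E) 0 δ = truncatedFracMeanCurvature s E 0 δ := by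
  rw [truncatedFracMeanCurvature_zero, truncatedFracMeanCurvature_zero,
    setIntegral_signedIndicator_preimage_isometry s φ E (by ext q; simp)]

theorem abs_truncatedFracMeanCurvature_le (hs0 : 0 < s) (hs1 : s < 1) (hr : 0 < r) (E : Set V)
    (p : V) :
    |truncatedFracMeanCurvature s E p r| ≤
      s * (1 - s) * ∫ q in (Metric.ball (0 : V) r)ᶜ, fracKernel s q := by
  have hc : 0 ≤ s * (1 - s) := mul_nonneg hs0.le (by linarith)
  rw [truncatedFracMeanCurvature_eq_preimage_add, truncatedFracMeanCurvature_zero, abs_mul,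
    abs_of_nonneg hc]
  refine mul_le_mul_of_nonneg_left ?_ hc
  rw [← Real.norm_eq_abs]
  refine norm_integral_le_of_norm_le (integrableOn_fracKernel_compl_ball hs0 hr)
    (ae_of_all _ fun q => ?_)
  rw [norm_mul, Real.norm_eq_abs, abs_signedIndicator, one_mul,
    Real.norm_of_nonneg (fracKernel_nonneg s q)]

theorem truncatedFracMeanCurvature_zero_le_add (hs0 : 0 < s) (hs1 : s < 1) (hr : 0 < r)
    (hE : MeasurableSet E) (hF : MeasurableSet F) :
    truncatedFracMeanCurvature s E 0 r ≤
      truncatedFracMeanCurvature s F 0 r + ∫ q in (Metric.ball 0 r)ᶜ ∩ (F \ E), fracKernel s q := by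
  have hcompare := setIntegral_signedIndicator_mul_le hE hF
    (integrableOn_fracKernel_compl_ball hs0 hr) (fracKernel_nonneg s)
  have hmass : 0 ≤ ∫ q in (Metric.ball 0 r)ᶜ ∩ (F \ E), fracKernel s q :=
    integral_nonneg fun q => fracKernel_nonneg s q
  have hc : 0 ≤ s * (1 - s) := mul_nonneg hs0.le (by linarith)
  have hc' : s * (1 - s) * 2 ≤ 1 := by nlinarith [sq_nonneg (2 * s - 1)]
  rw [truncatedFracMeanCurvature_zero, truncatedFracMeanCurvature_zero]
  nlinarith

theorem truncatedFracMeanCurvature_zero_sub_le (hs0 : 0 < s) (hs1 : s < 1) (hδ : 0 < δ)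
    (hδr : δ ≤ r) (hE : MeasurableSet E) :
    truncatedFracMeanCurvature s E 0 r - ∫ q in (Metric.ball 0 r \ Metric.ball 0 δ) ∩ (E ∩ -E),
      fracKernel s q ≤ truncatedFracMeanCurvature s E 0 δ := by
  have hk := integrableOn_fracKernel_compl_ball (V := V) hs0 hδ
  have hannulus := neg_setIntegral_inter_neg_le hE (s := s)
    (A := (Metric.ball 0 δ)ᶜ \ (Metric.ball 0 r)ᶜ) (by ext q; simp)
    (hk.mono_set Set.sdiff_subset)
  rw [setIntegral_sdiff measurableSet_ball.compl (integrable_signedIndicator_mul hE hk)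
    (Set.compl_subset_compl.2 (Metric.ball_subset_ball hδr)), compl_sdiff_compl] at hannulus
  have hmass : 0 ≤ ∫ q in (Metric.ball 0 r \ Metric.ball 0 δ) ∩ (E ∩ -E), fracKernel s q :=
    integral_nonneg fun q => fracKernel_nonneg s q
  have hc : 0 ≤ s * (1 - s) := mul_nonneg hs0.le (by linarith)
  have hc' : s * (1 - s) ≤ 1 := by nlinarith
  rw [truncatedFracMeanCurvature_zero, truncatedFracMeanCurvature_zero]
  nlinarith

end TruncatedCurvature

section Slab

variable {X : Type*} [NormedAddCommGroup X]

theorem norm_fst_le_norm (q : WithLp 2 (X × ℝ)) : ‖q.fst‖ ≤ ‖q‖ := by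
  rw [WithLp.prod_norm_eq_of_L2]
  exact Real.le_sqrt_of_sq_le (by linarith [sq_nonneg ‖q.snd‖])

variable [InnerProductSpace ℝ X] {s r C : ℝ}

theorem fracKernel_le_norm_fst_rpow_neg (hs : 0 < s) {p : X} {q : WithLp 2 (X × ℝ)}
    (hq : |q.snd - ⟪p, q.fst⟫| ≤ C * ‖q.fst‖ ^ 2) :
    fracKernel s q ≤ ‖q.fst‖ ^ (-(Module.finrank ℝ (WithLp 2 (X × ℝ)) + s)) := by
  have ha : 0 < (Module.finrank ℝ (WithLp 2 (X × ℝ)) : ℝ) + s := by positivity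
  by_cases hz : q.fst = 0
  · have hsnd : q.snd = 0 := by simpa [hz] using hq
    have hnorm : ‖q‖ = 0 := by rw [WithLp.prod_norm_eq_of_L2, hz, hsnd]; simp
    rw [fracKernel, hnorm, Real.zero_rpow ha.ne', div_zero]
    positivity
  · have hpos : 0 < ‖q.fst‖ := norm_pos_iff.2 hz
    rw [fracKernel, Real.rpow_neg hpos.le, ← one_div]
    exact one_div_le_one_div_of_le (by positivity)
      (Real.rpow_le_rpow hpos.le (norm_fst_le_norm q) ha.le)

variable [FiniteDimensional ℝ X]

theorem finrank_withLp_prod_real :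
    Module.finrank ℝ (WithLp 2 (X × ℝ)) = Module.finrank ℝ X + 1 := by
  rw [(WithLp.linearEquiv 2 ℝ (X × ℝ)).finrank_eq, Module.finrank_prod, Module.finrank_self]

variable [MeasurableSpace X] [BorelSpace X] {S : Set (WithLp 2 (X × ℝ))}

theorem setIntegral_le_of_volume_section_le {A : Set X} {k : WithLp 2 (X × ℝ) → ℝ} {b φ : X → ℝ}
    (hS : MeasurableSet S) (hA : MeasurableSet A) (hSA : ∀ q ∈ S, q.fst ∈ A)
    (hk : Measurable k) (hk0 : ∀ q, 0 ≤ k q) (hkφ : ∀ q ∈ S, k q ≤ φ q.fst)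
    (hb0 : ∀ z, 0 ≤ b z) (hφ0 : ∀ z, 0 ≤ φ z)
    (hb : ∀ z, volume {ζ : ℝ | WithLp.toLp 2 (z, ζ) ∈ S} ≤ ENNReal.ofReal (b z))
    (hbφ : IntegrableOn (fun z => b z * φ z) A) :
    ∫ q in S, k q ≤ ∫ z in A, b z * φ z := by
  have hnonneg : ∀ z, 0 ≤ b z * φ z := fun z => mul_nonneg (hb0 z) (hφ0 z)
  have hmeas : Measurable (S.indicator fun q => ENNReal.ofReal (k q)) :=
    hk.ennreal_ofReal.indicator hS
  rw [integral_eq_lintegral_of_nonneg_ae (ae_of_all _ hk0) hk.aestronglyMeasurable]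
  refine ENNReal.toReal_le_of_le_ofReal (integral_nonneg hnonneg) ?_
  rw [ofReal_integral_eq_lintegral_ofReal hbφ (ae_of_all _ hnonneg), ← lintegral_indicator hS,
    ← lintegral_indicator hA, ← (WithLp.volume_preserving_toLp X ℝ).lintegral_comp hmeas,
    Measure.volume_eq_prod, lintegral_prod (fun x => S.indicator _ (WithLp.toLp 2 x))
      (hmeas.comp (WithLp.volume_preserving_toLp X ℝ).measurable).aemeasurable]
  refine lintegral_mono fun z => ?_
  by_cases hz : z ∈ A
  · calc ∫⁻ ζ : ℝ, S.indicator (fun q => ENNReal.ofReal (k q)) (WithLp.toLp 2 (z, ζ))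
        ≤ ∫⁻ ζ : ℝ, {ζ | WithLp.toLp 2 (z, ζ) ∈ S}.indicator
            (fun _ => ENNReal.ofReal (φ z)) ζ :=
          lintegral_mono fun ζ => by
            by_cases hζ : WithLp.toLp 2 (z, ζ) ∈ S
            · simpa [hζ] using ENNReal.ofReal_le_ofReal (hkφ _ hζ)
            · simp [hζ]
      _ ≤ ENNReal.ofReal (φ z) * volume {ζ : ℝ | WithLp.toLp 2 (z, ζ) ∈ S} :=
          lintegral_indicator_const_le _ _
      _ ≤ ENNReal.ofReal (φ z) * ENNReal.ofReal (b z) := by gcongr; exact hb z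
      _ = A.indicator (fun z => ENNReal.ofReal (b z * φ z)) z := by
          rw [Set.indicator_of_mem hz, mul_comm, ENNReal.ofReal_mul (hb0 z)]
  · have hzero : ∀ ζ : ℝ, S.indicator (fun q => ENNReal.ofReal (k q)) (WithLp.toLp 2 (z, ζ)) = 0 :=
      fun ζ => Set.indicator_of_notMem (fun hζ => hz (hSA (WithLp.toLp 2 (z, ζ)) hζ)) _
    simp only [hzero, lintegral_zero, zero_le]

theorem integrableOn_norm_rpow_ball {α : ℝ} (hα : -(Module.finrank ℝ X : ℝ) < α) (r : ℝ) :
    IntegrableOn (fun z : X => ‖z‖ ^ α) (Metric.ball 0 r) := by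
  rcases Nat.eq_zero_or_pos (Module.finrank ℝ X) with hX | hX
  · have : Subsingleton X := Module.finrank_zero_iff.1 hX
    have hconst : (fun z : X => ‖z‖ ^ α) = fun _ => ‖(0 : X)‖ ^ α :=
      funext fun z => by rw [Subsingleton.elim z 0]
    rw [hconst]
    exact integrableOn_const Metric.isBounded_ball.measure_lt_top.ne
  · exact integrableOn_ball_of_norm_le_rpow (C := 1) (α := -α) hX (by linarith)
      (ae_of_all _ fun z => by
        rw [neg_neg, one_mul, Real.norm_of_nonneg (by positivity)])
      (by fun_prop : Measurable fun z : X => ‖z‖ ^ α).aestronglyMeasurable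

theorem setIntegral_ball_norm_rpow (hr : 0 < r) (α : ℝ) :
    ∫ z in Metric.ball (0 : X) r, ‖z‖ ^ α =
      r ^ (Module.finrank ℝ X + α) * ∫ z in Metric.ball (0 : X) 1, ‖z‖ ^ α := by
  have h := Measure.setIntegral_comp_smul_of_pos (volume : Measure X) (fun z => ‖z‖ ^ α)
    (Metric.ball 0 1) hr
  have hscale : ∀ z : X, ‖r • z‖ ^ α = r ^ α * ‖z‖ ^ α := fun z => by
    rw [norm_smul, Real.norm_of_nonneg hr.le, Real.mul_rpow hr.le (norm_nonneg z)]
  simp only [hscale, smul_unitBall_of_pos hr, integral_const_mul, smul_eq_mul] at h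
  rw [Real.rpow_add hr, Real.rpow_natCast, mul_assoc, h, mul_inv_cancel_left₀ (by positivity)]

variable (X) in
/-- Twice the mass of `‖z‖ ^ (1 - s - dim X)` on the unit ball. It bounds the mass of `fracKernel s`
on sets pinched to second order along a hyperplane that is a graph over `X`. -/
noncomputable def slabConstant (s : ℝ) : ℝ :=
  2 * ∫ z in Metric.ball (0 : X) 1, ‖z‖ ^ (1 - s - Module.finrank ℝ X)

theorem setIntegral_fracKernel_slab_le (hs0 : 0 < s) (hs1 : s < 1) (hr : 0 < r) (hC : 0 ≤ C)
    (hS : MeasurableSet S) (hSr : S ⊆ Metric.ball 0 r) {p : X}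
    (hSp : ∀ q ∈ S, |q.snd - ⟪p, q.fst⟫| ≤ C * ‖q.fst‖ ^ 2) :
    ∫ q in S, fracKernel s q ≤ C * slabConstant X s * r ^ (1 - s) := by
  set n : ℝ := (Module.finrank ℝ X : ℝ) with hn
  have hexp : (2 : ℝ) + -(Module.finrank ℝ (WithLp 2 (X × ℝ)) + s) = 1 - s - n := by
    rw [finrank_withLp_prod_real]; push_cast; ring
  have hexp0 : 1 - s - n ≠ 0 := by
    rcases Nat.eq_zero_or_pos (Module.finrank ℝ X) with hX | hX
    · simp only [hn, hX, CharP.cast_eq_zero]; linarith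
    · have : (1 : ℝ) ≤ n := Nat.one_le_cast.2 hX
      linarith
  have hweight : ∀ z : X, 2 * C * ‖z‖ ^ 2 * ‖z‖ ^ (-(Module.finrank ℝ (WithLp 2 (X × ℝ)) + s)) =
      2 * C * ‖z‖ ^ (1 - s - n) := fun z => by
    rw [mul_assoc, ← Real.rpow_two, ← Real.rpow_add' (norm_nonneg z) (hexp ▸ hexp0), hexp]
  calc ∫ q in S, fracKernel s q
      ≤ ∫ z in Metric.ball (0 : X) r,
          2 * C * ‖z‖ ^ 2 * ‖z‖ ^ (-(Module.finrank ℝ (WithLp 2 (X × ℝ)) + s)) := by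
        refine setIntegral_le_of_volume_section_le hS measurableSet_ball
          (fun q hq => mem_ball_zero_iff.2 ?_) (measurable_fracKernel s) (fracKernel_nonneg s)
          (fun q hq => fracKernel_le_norm_fst_rpow_neg hs0 (hSp q hq))
          (fun z => by positivity) (fun z => by positivity) (fun z => ?_) ?_
        · exact (norm_fst_le_norm q).trans_lt (mem_ball_zero_iff.1 (hSr hq))
        · refine (measure_mono (t := Set.Icc (⟪p, z⟫ - C * ‖z‖ ^ 2) (⟪p, z⟫ + C * ‖z‖ ^ 2))
            fun ζ hζ => ?_).trans ?_
          · have h : |ζ - ⟪p, z⟫| ≤ C * ‖z‖ ^ 2 := hSp _ hζ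
            rw [abs_le] at h
            exact ⟨by linarith [h.1], by linarith [h.2]⟩
          · rw [Real.volume_Icc]
            exact ENNReal.ofReal_le_ofReal (by linarith)
        · simp only [hweight]
          exact (integrableOn_norm_rpow_ball (by linarith) r).const_mul _
    _ = C * slabConstant X s * r ^ (1 - s) := by
        simp only [hweight, integral_const_mul]
        rw [setIntegral_ball_norm_rpow hr, slabConstant, ← hn, add_sub_cancel]
        ring

theorem exists_setIntegral_fracKernel_thin_le (X : Type*) [NormedAddCommGroup X]
    [InnerProductSpace ℝ X] [FiniteDimensional ℝ X] [MeasurableSpace X] [BorelSpace X]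
    (hs : 0 < s) (hr : 0 < r) :
    ∃ N : ℝ, 0 ≤ N ∧ ∀ (S : Set (WithLp 2 (X × ℝ))) (ε : ℝ), MeasurableSet S → 0 ≤ ε →
      (∀ z, volume {ζ : ℝ | WithLp.toLp 2 (z, ζ) ∈ S} ≤ ENNReal.ofReal (ε * ‖z‖)) →
      ∫ q in (Metric.ball 0 r)ᶜ ∩ S, fracKernel s q ≤ ε * N := by
  set a : ℝ := Module.finrank ℝ (WithLp 2 (X × ℝ)) + s with ha
  set c : ℝ := ((1 + r) / r) ^ a
  have ha0 : 0 < a := by positivity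
  have hint : Integrable fun z : X => ‖z‖ * (c * (1 + ‖z‖) ^ (-a)) := by
    refine ((integrable_one_add_norm (E := X) (μ := volume) (r := a - 1) ?_).const_mul c).mono'
      (by fun_prop : Measurable _).aestronglyMeasurable (ae_of_all _ fun z => ?_)
    · rw [ha, finrank_withLp_prod_real]; push_cast; linarith
    · have hz : (0 : ℝ) < 1 + ‖z‖ := by positivity
      rw [Real.norm_of_nonneg (by positivity), neg_sub, sub_eq_add_neg, Real.rpow_add hz,
        Real.rpow_one, mul_left_comm]
      gcongr
      linarith
  refine ⟨∫ z : X, ‖z‖ * (c * (1 + ‖z‖) ^ (-a)), integral_nonneg fun z => by positivity,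
    fun S ε hS hε hb => ?_⟩
  have hle : ∫ q in (Metric.ball 0 r)ᶜ ∩ S, fracKernel s q ≤
      ∫ z in (Set.univ : Set X), ε * ‖z‖ * (c * (1 + ‖z‖) ^ (-a)) := by
    refine setIntegral_le_of_volume_section_le (measurableSet_ball.compl.inter hS)
      MeasurableSet.univ (fun _ _ => Set.mem_univ _) (measurable_fracKernel s) (fracKernel_nonneg s)
      (fun q hq => ?_) (fun z => by positivity)
      (fun z => by positivity) (fun z => (measure_mono fun ζ hζ => hζ.2).trans (hb z))
      (by simpa only [mul_assoc] using (hint.const_mul ε).integrableOn)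
    refine (fracKernel_le_mul_one_add_norm_rpow_neg hs hr (by simpa using hq.1)).trans ?_
    gcongr ?_ * ?_
    exact Real.rpow_le_rpow_of_nonpos (by positivity) (by linarith [norm_fst_le_norm q])
      (neg_nonpos.2 ha0.le)
  simpa only [Measure.restrict_univ, mul_assoc, integral_const_mul] using hle

theorem exists_truncatedFracMeanCurvature_zero_le_of_thin (X : Type*) [NormedAddCommGroup X]
    [InnerProductSpace ℝ X] [FiniteDimensional ℝ X] [MeasurableSpace X] [BorelSpace X]
    (hs0 : 0 < s) (hs1 : s < 1) (hr : 0 < r) :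
    ∃ N : ℝ, 0 ≤ N ∧ ∀ (E F : Set (WithLp 2 (X × ℝ))) (ε : ℝ), MeasurableSet E → MeasurableSet F →
      0 ≤ ε → (∀ z, volume {ζ : ℝ | WithLp.toLp 2 (z, ζ) ∈ F \ E} ≤ ENNReal.ofReal (ε * ‖z‖)) →
      truncatedFracMeanCurvature s E 0 r ≤ truncatedFracMeanCurvature s F 0 r + ε * N := by
  obtain ⟨N, hN, hthin⟩ := exists_setIntegral_fracKernel_thin_le X hs0 hr
  refine ⟨N, hN, fun E F ε hE hF hε hsection => ?_⟩
  have hcompare := truncatedFracMeanCurvature_zero_le_add hs0 hs1 hr hE hF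
  linarith [hthin (F \ E) ε (hF.diff hE) hε hsection]

end Slab

section Subgraph

variable {d : ℕ} {s r : ℝ} {f g : EuclideanSpace ℝ (Fin d) → ℝ}

/-- `f (x + z) - f x` as a function of `z`: the graph of `f` seen from its point over `x`. -/
def increment {X : Type*} [Add X] (f : X → ℝ) (x z : X) : ℝ :=
  f (x + z) - f x

/-- The truncated integral whose principal value is `graphCurvature s f x`. -/
noncomputable def truncatedGraphCurvature (s : ℝ) (f : EuclideanSpace ℝ (Fin d) → ℝ)
    (x : EuclideanSpace ℝ (Fin d)) : ℝ → ℝ :=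
  truncatedFracMeanCurvature s (subgraph f) (graphPoint f x)

theorem truncatedGraphCurvature_eq_increment (s : ℝ) (f : EuclideanSpace ℝ (Fin d) → ℝ)
    (x : EuclideanSpace ℝ (Fin d)) (r : ℝ) :
    truncatedGraphCurvature s f x r =
      truncatedFracMeanCurvature s (subgraph (increment f x)) 0 r := by
  have hpre : (graphPoint f x + ·) ⁻¹' subgraph f = subgraph (increment f x) := by
    ext q
    change f x + q.snd ≤ f (x + q.fst) ↔ q.snd ≤ f (x + q.fst) - f x
    exact le_sub_iff_add_le'.symm
  rw [truncatedGraphCurvature, truncatedFracMeanCurvature_eq_preimage_add, hpre]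

theorem measurableSet_subgraph (hf : Measurable f) : MeasurableSet (subgraph f) := by
  unfold subgraph
  exact measurableSet_le (by fun_prop) (by fun_prop)

theorem measurable_increment (hf : Measurable f) (x : EuclideanSpace ℝ (Fin d)) :
    Measurable (increment f x) := by
  unfold increment
  fun_prop

/-- The reflection `(z, ζ) ↦ (z, -ζ)`. -/
noncomputable def verticalReflection (d : ℕ) : GraphSpace d ≃ₗᵢ[ℝ] GraphSpace d where
  toLinearEquiv := (WithLp.linearEquiv 2 ℝ _).trans
    (((LinearEquiv.refl ℝ _).prodCongr (LinearEquiv.neg ℝ)).trans (WithLp.linearEquiv 2 ℝ _).symm)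
  norm_map' q := by simp [WithLp.prod_norm_eq_of_L2]

/-- The reflected subgraph of `f` is the complement of the subgraph of `-f`, up to the graph, which
is a null set. -/
theorem truncatedFracMeanCurvature_subgraph_neg (hs0 : 0 < s) (hs1 : s < 1) (hr : 0 < r)
    (hf : Measurable f) :
    truncatedFracMeanCurvature s (subgraph (-f)) 0 r =
      -truncatedFracMeanCurvature s (subgraph f) 0 r := by
  obtain ⟨N, -, hthin⟩ :=
    exists_truncatedFracMeanCurvature_zero_le_of_thin (EuclideanSpace ℝ (Fin d)) hs0 hs1 hr
  set R : Set (GraphSpace d) := verticalReflection d ⁻¹' subgraph f with hR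
  have hRm : MeasurableSet Rᶜ :=
    ((measurableSet_subgraph hf).preimage (verticalReflection d).continuous.measurable).compl
  have hneg := measurableSet_subgraph hf.neg
  have hle : truncatedFracMeanCurvature s (subgraph (-f)) 0 r ≤
      truncatedFracMeanCurvature s Rᶜ 0 r + 0 * N := by
    refine hthin _ _ 0 hneg hRm le_rfl fun z => ?_
    refine (measure_mono_null (t := ∅) (fun ζ hζ => hζ.2 ?_) measure_empty).le.trans zero_le
    have hlt : ¬ -ζ ≤ f z := hζ.1
    change ζ ≤ -f z
    linarith
  have hge : truncatedFracMeanCurvature s Rᶜ 0 r ≤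
      truncatedFracMeanCurvature s (subgraph (-f)) 0 r + 0 * N := by
    refine hthin _ _ 0 hRm hneg le_rfl fun z => ?_
    refine (measure_mono_null (t := {-f z}) (fun ζ hζ => ?_) (measure_singleton _)).le.trans
      zero_le
    have hle : ζ ≤ -f z := hζ.1
    have hge : -ζ ≤ f z := not_not.1 hζ.2
    exact le_antisymm hle (by linarith)
  rw [truncatedFracMeanCurvature_compl, hR, truncatedFracMeanCurvature_zero_preimage_isometry]
    at hle hge
  linarith

theorem truncatedGraphCurvature_neg (hs0 : 0 < s) (hs1 : s < 1) (hr : 0 < r) (hf : Measurable f)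
    (x : EuclideanSpace ℝ (Fin d)) :
    truncatedGraphCurvature s (-f) x r = -truncatedGraphCurvature s f x r := by
  have hincrement : increment (-f) x = -increment f x := by
    ext z; simp only [increment, Pi.neg_apply]; ring
  rw [truncatedGraphCurvature_eq_increment, truncatedGraphCurvature_eq_increment, hincrement,
    truncatedFracMeanCurvature_subgraph_neg hs0 hs1 hr (measurable_increment hf x)]

/-- Seen from their points, the graph of `f` lies below that of `-g` up to a cone of slope `ε`. -/
theorem exists_neg_le_truncatedGraphCurvature_add (d : ℕ) (hs0 : 0 < s) (hs1 : s < 1)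
    (hr : 0 < r) :
    ∃ N : ℝ, 0 ≤ N ∧ ∀ (f g : EuclideanSpace ℝ (Fin d) → ℝ) (x y : EuclideanSpace ℝ (Fin d))
      (ε : ℝ), Measurable f → Measurable g → 0 ≤ ε →
      (∀ z, increment f x z + increment g y z ≤ ε * ‖z‖) →
      -(ε * N) ≤ truncatedGraphCurvature s f x r + truncatedGraphCurvature s g y r := by
  obtain ⟨N, hN, hthin⟩ :=
    exists_truncatedFracMeanCurvature_zero_le_of_thin (EuclideanSpace ℝ (Fin d)) hs0 hs1 hr
  refine ⟨N, hN, fun f g x y ε hf hg hε hfg => ?_⟩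
  have hle := hthin (subgraph (-increment g y)) (subgraph (increment f x)) ε
    (measurableSet_subgraph (measurable_increment hg y).neg)
    (measurableSet_subgraph (measurable_increment hf x)) hε fun z => by
      refine (measure_mono (t := Set.Icc (-increment g y z) (increment f x z)) fun ζ hζ => ?_).trans
        ?_
      · exact ⟨(not_le.1 hζ.2).le, hζ.1⟩
      · rw [Real.volume_Icc]
        exact ENNReal.ofReal_le_ofReal (by linarith [hfg z])
  rw [truncatedFracMeanCurvature_subgraph_neg hs0 hs1 hr (measurable_increment hg y),
    ← truncatedGraphCurvature_eq_increment, ← truncatedGraphCurvature_eq_increment] at hle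
  linarith

theorem truncatedGraphCurvature_sub_le_of_le_paraboloid (hs0 : 0 < s) (hs1 : s < 1) (hr : 0 < r)
    (hf : Measurable f) {x p : EuclideanSpace ℝ (Fin d)} {C h : ℝ} (hC : 0 ≤ C)
    (hh : HasFracMeanCurvature s (subgraph f) (graphPoint f x) h)
    (hfp : ∀ z, increment f x z ≤ ⟪p, z⟫ + C * ‖z‖ ^ 2) :
    truncatedGraphCurvature s f x r -
      C * slabConstant (EuclideanSpace ℝ (Fin d)) s * r ^ (1 - s) ≤ h := by
  have hE := measurableSet_subgraph (measurable_increment hf x)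
  refine ge_of_tendsto hh ?_
  filter_upwards [Ioo_mem_nhdsGT hr] with δ hδ
  have hsub := truncatedFracMeanCurvature_zero_sub_le hs0 hs1 hδ.1 hδ.2.le hE
  rw [← truncatedGraphCurvature_eq_increment, ← truncatedGraphCurvature_eq_increment] at hsub
  refine le_trans (sub_le_sub_left ?_ _) hsub
  refine setIntegral_fracKernel_slab_le hs0 hs1 hr hC
    ((measurableSet_ball.diff measurableSet_ball).inter (hE.inter hE.neg)) (fun q hq => hq.1.1)
    (p := p) fun q hq => abs_le.2 ⟨?_, ?_⟩
  · have hle : -q.snd ≤ increment f x (-q.fst) := hq.2.2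
    have htouch := hfp (-q.fst)
    rw [inner_neg_right, norm_neg] at htouch
    linarith
  · have hle : q.snd ≤ increment f x q.fst := hq.2.1
    linarith [hfp q.fst]

theorem hasFracMeanCurvature_graphCurvature {x : EuclideanSpace ℝ (Fin d)}
    (hf : ∃ h, HasFracMeanCurvature s (subgraph f) (graphPoint f x) h) :
    HasFracMeanCurvature s (subgraph f) (graphPoint f x) (graphCurvature s f x) :=
  tendsto_nhds_limUnder hf

theorem hasFracMeanCurvature_subgraph_neg (hs0 : 0 < s) (hs1 : s < 1) (hf : Measurable f)
    {x : EuclideanSpace ℝ (Fin d)} {h : ℝ}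
    (hh : HasFracMeanCurvature s (subgraph f) (graphPoint f x) h) :
    HasFracMeanCurvature s (subgraph (-f)) (graphPoint (-f) x) (-h) := by
  refine (Tendsto.neg hh).congr' ?_
  filter_upwards [self_mem_nhdsWithin] with δ hδ
  exact (truncatedGraphCurvature_neg hs0 hs1 hδ hf x).symm

end Subgraph

section Bracket

variable {X : Type*} [NormedAddCommGroup X]

/-- The Japanese bracket `⟨x⟩ = √(1 + ‖x‖²)`: a smooth function at bounded distance from the norm,
and, evaluated at the gradient of a function, the area factor of its graph. -/
noncomputable def japaneseBracket (x : X) : ℝ :=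
  √(1 + ‖x‖ ^ 2)

theorem japaneseBracket_sq (x : X) : japaneseBracket x ^ 2 = 1 + ‖x‖ ^ 2 :=
  Real.sq_sqrt (by positivity)

theorem one_le_japaneseBracket (x : X) : 1 ≤ japaneseBracket x :=
  Real.one_le_sqrt.2 (le_add_of_nonneg_right (sq_nonneg _))

theorem japaneseBracket_pos (x : X) : 0 < japaneseBracket x :=
  one_pos.trans_le (one_le_japaneseBracket x)

theorem norm_le_japaneseBracket (x : X) : ‖x‖ ≤ japaneseBracket x :=
  Real.le_sqrt_of_sq_le (by linarith)

@[simp]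
theorem japaneseBracket_zero : japaneseBracket (0 : X) = 1 := by
  simp [japaneseBracket]

@[simp]
theorem japaneseBracket_neg (x : X) : japaneseBracket (-x) = japaneseBracket x := by
  simp [japaneseBracket]

@[fun_prop]
theorem continuous_japaneseBracket : Continuous (japaneseBracket : X → ℝ) := by
  unfold japaneseBracket
  fun_prop

theorem japaneseBracket_le_of_norm_le {x : X} {L : ℝ} (h : ‖x‖ ≤ L) :
    japaneseBracket x ≤ √(1 + L ^ 2) := by
  unfold japaneseBracket
  gcongr

theorem japaneseBracket_add_le (x z : X) :
    japaneseBracket (x + z) ≤ japaneseBracket x + ‖z‖ := by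
  have htriangle := pow_le_pow_left₀ (norm_nonneg _) (norm_add_le x z) 2
  have hcross := mul_le_mul_of_nonneg_right (norm_le_japaneseBracket x) (norm_nonneg z)
  refine Real.sqrt_le_iff.2 ⟨add_nonneg (japaneseBracket_pos x).le (norm_nonneg z), ?_⟩
  linarith [add_sq (japaneseBracket x) ‖z‖, japaneseBracket_sq x, add_sq ‖x‖ ‖z‖]

theorem abs_japaneseBracket_add_sub_le (x z : X) :
    |japaneseBracket (x + z) - japaneseBracket x| ≤ ‖z‖ := by
  have hback := japaneseBracket_add_le (x + z) (-z)
  rw [add_neg_cancel_right, norm_neg] at hback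
  exact abs_le.2 ⟨by linarith, by linarith [japaneseBracket_add_le x z]⟩

variable [InnerProductSpace ℝ X]

theorem norm_inv_japaneseBracket_smul_le_one (x : X) : ‖(japaneseBracket x)⁻¹ • x‖ ≤ 1 := by
  rw [norm_smul, norm_inv, Real.norm_of_nonneg (japaneseBracket_pos x).le,
    inv_mul_le_one₀ (japaneseBracket_pos x)]
  exact norm_le_japaneseBracket x

theorem japaneseBracket_add_le_add_inner (x z : X) :
    japaneseBracket (x + z) ≤
      japaneseBracket x + ⟪(japaneseBracket x)⁻¹ • x, z⟫ + 1 / 2 * ‖z‖ ^ 2 := by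
  have hpos := japaneseBracket_pos x
  have hexpand : japaneseBracket (x + z) ^ 2 = japaneseBracket x ^ 2 + 2 * ⟪x, z⟫ + ‖z‖ ^ 2 := by
    rw [japaneseBracket_sq, japaneseBracket_sq, norm_add_sq_real]; ring
  have hquot : ‖z‖ ^ 2 / japaneseBracket x ≤ ‖z‖ ^ 2 :=
    div_le_self (by positivity) (one_le_japaneseBracket x)
  calc japaneseBracket (x + z)
    _ ≤ (japaneseBracket (x + z) ^ 2 + japaneseBracket x ^ 2) / (2 * japaneseBracket x) := by
        rw [le_div_iff₀ (by positivity)]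
        linarith [two_mul_le_add_sq (japaneseBracket (x + z)) (japaneseBracket x)]
    _ = japaneseBracket x + ⟪x, z⟫ / japaneseBracket x + 1 / 2 * (‖z‖ ^ 2 / japaneseBracket x) := by
        rw [hexpand]; field_simp; ring
    _ ≤ japaneseBracket x + ⟪(japaneseBracket x)⁻¹ • x, z⟫ + 1 / 2 * ‖z‖ ^ 2 := by
        rw [real_inner_smul_left, inv_mul_eq_div]; gcongr

end Bracket

section DoublingPenalty

variable {X : Type*} [NormedAddCommGroup X] {η ε : ℝ}

/-- The penalty subtracted from `f x + g y` when variables are doubled: the first term forces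
`x` and `y` together, the second keeps a maximizing pair bounded. -/
noncomputable def doublingPenalty (η ε : ℝ) (x y : X) : ℝ :=
  ‖x - y‖ ^ 2 / (2 * η) + ε * japaneseBracket x

@[fun_prop]
theorem continuous_doublingPenalty (η ε : ℝ) :
    Continuous fun q : X × X => doublingPenalty η ε q.1 q.2 := by
  unfold doublingPenalty
  fun_prop

theorem doublingPenalty_self (η ε : ℝ) (x : X) :
    doublingPenalty η ε x x = ε * japaneseBracket x := by
  simp [doublingPenalty]

theorem doublingPenalty_add_add_le (hε : 0 ≤ ε) (x y z : X) :
    doublingPenalty η ε (x + z) (y + z) ≤ doublingPenalty η ε x y + ε * ‖z‖ := by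
  rw [doublingPenalty, doublingPenalty, add_sub_add_right_eq_sub, add_assoc, ← mul_add]
  gcongr
  exact japaneseBracket_add_le x z

theorem mul_sub_sq_div_le (hη : 0 < η) (L ρ : ℝ) : L * ρ - ρ ^ 2 / (2 * η) ≤ L ^ 2 * η / 2 := by
  have hsquare : L ^ 2 * η / 2 - (L * ρ - ρ ^ 2 / (2 * η)) = (L * η - ρ) ^ 2 / (2 * η) := by
    field_simp; ring
  have hnonneg : 0 ≤ (L * η - ρ) ^ 2 / (2 * η) := by positivity
  linarith

theorem mul_norm_sub_sub_doublingPenalty_le (hη : 0 < η) (hε : 0 ≤ ε) (L : ℝ) (x y : X) :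
    L * ‖x - y‖ - doublingPenalty η ε x y ≤ L ^ 2 * η / 2 := by
  have hbracket := mul_nonneg hε (japaneseBracket_pos x).le
  rw [doublingPenalty]
  linarith [mul_sub_sq_div_le hη L ‖x - y‖]

theorem mul_norm_sub_sub_doublingPenalty_le_sub_norm (hη : 0 < η) (hε : 0 ≤ ε) (L : ℝ)
    (q : X × X) :
    L * ‖q.1 - q.2‖ - doublingPenalty η ε q.1 q.2 ≤ (L + ε) ^ 2 * η / 2 - ε * ‖q‖ := by
  have hsnd : ‖q.2‖ ≤ ‖q.1‖ + ‖q.1 - q.2‖ := by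
    simpa only [sub_sub_cancel] using norm_sub_le q.1 (q.1 - q.2)
  have hnorm : ‖q‖ ≤ ‖q.1‖ + ‖q.1 - q.2‖ :=
    max_le (le_add_of_nonneg_right (norm_nonneg _)) hsnd
  have hbracket : ε * ‖q‖ ≤ ε * (japaneseBracket q.1 + ‖q.1 - q.2‖) := by
    gcongr
    exact hnorm.trans (add_le_add_left (norm_le_japaneseBracket q.1) _)
  rw [doublingPenalty]
  linarith [mul_sub_sq_div_le hη (L + ε) ‖q.1 - q.2‖]

variable [InnerProductSpace ℝ X]

theorem norm_add_sq_div_eq (η : ℝ) (w z : X) :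
    ‖w + z‖ ^ 2 / (2 * η) = ‖w‖ ^ 2 / (2 * η) + ⟪η⁻¹ • w, z⟫ + 1 / (2 * η) * ‖z‖ ^ 2 := by
  rw [norm_add_sq_real, real_inner_smul_left]
  ring

theorem doublingPenalty_add_left_le (hε : 0 ≤ ε) (x y z : X) :
    doublingPenalty η ε (x + z) y ≤ doublingPenalty η ε x y +
      ⟪η⁻¹ • (x - y) + ε • (japaneseBracket x)⁻¹ • x, z⟫ + (1 / (2 * η) + ε / 2) * ‖z‖ ^ 2 := by
  have hbracket := mul_le_mul_of_nonneg_left (japaneseBracket_add_le_add_inner x z) hε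
  rw [doublingPenalty, doublingPenalty, add_sub_right_comm, norm_add_sq_div_eq, inner_add_left,
    real_inner_smul_left _ z ε]
  linarith

theorem doublingPenalty_add_right (η ε : ℝ) (x y z : X) :
    doublingPenalty η ε x (y + z) =
      doublingPenalty η ε x y + ⟪-(η⁻¹ • (x - y)), z⟫ + 1 / (2 * η) * ‖z‖ ^ 2 := by
  rw [doublingPenalty, doublingPenalty, ← sub_sub, sub_eq_add_neg (x - y), norm_add_sq_div_eq,
    norm_neg, inner_neg_right, inner_neg_left]
  ring

end DoublingPenalty

section Maximum

variable {X : Type*} [NormedAddCommGroup X] [ProperSpace X] {T A B K c : ℝ}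

theorem exists_isMaxOn_of_le_sub_mul_norm {Φ : ℝ × X → ℝ} (hT : 0 ≤ T) (hc : 0 < c)
    (hΦ : ContinuousOn Φ (Set.Icc 0 T ×ˢ Set.univ))
    (hdecay : ∀ t ∈ Set.Icc 0 T, ∀ x, Φ (t, x) ≤ A - c * ‖x‖) :
    ∃ t ∈ Set.Icc 0 T, ∃ x, IsMaxOn Φ (Set.Icc 0 T ×ˢ Set.univ) (t, x) := by
  have hzero : ((0 : ℝ), (0 : X)) ∈ Set.Icc 0 T ×ˢ Set.univ := ⟨⟨le_rfl, hT⟩, Set.mem_univ _⟩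
  obtain ⟨q, hq, hmax⟩ := hΦ.exists_isMaxOn' (isClosed_Icc.prod isClosed_univ) hzero <| by
    rw [eventually_inf_principal]
    refine mem_cocompact.2
      ⟨Set.Icc 0 T ×ˢ Metric.closedBall 0 ((A - Φ (0, 0)) / c),
        isCompact_Icc.prod (isCompact_closedBall _ _), ?_⟩
    rintro ⟨t, x⟩ hout hin
    have hfar : (A - Φ (0, 0)) / c < ‖x‖ := by
      contrapose! hout
      exact not_not.2 ⟨hin.1, mem_closedBall_zero_iff.2 hout⟩
    rw [div_lt_iff₀ hc] at hfar
    linarith [hdecay t hin.1 x]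
  exact ⟨q.1, hq.1, q.2, hmax⟩

theorem hasDerivWithinAt_Iic_nonneg_of_max {g : ℝ → ℝ} {a t₀ t : ℝ}
    (hg : HasDerivWithinAt g a (Set.Iic t) t) (ht : t₀ < t) (hmax : ∀ τ ∈ Set.Ioo t₀ t, g τ ≤ g t) :
    0 ≤ a := by
  have hslope := (hasDerivWithinAt_iff_tendsto_slope' Set.self_notMem_Iio).1 hg.Iio_of_Iic
  refine ge_of_tendsto hslope ?_
  filter_upwards [Ioo_mem_nhdsLT ht] with τ hτ
  rw [slope_def_field]
  exact div_nonneg_of_nonpos (sub_nonpos.2 (hmax τ hτ)) (sub_nonpos.2 hτ.2.le)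

/-- Subtracting a little more than `K t` makes a positive maximal time impossible. -/
theorem le_add_mul_of_deriv_le_at_max {Φ : ℝ → X → ℝ} (hc : 0 < c)
    (hΦ : ContinuousOn (fun q : ℝ × X => Φ q.1 q.2) (Set.Icc 0 T ×ˢ Set.univ))
    (hdecay : ∀ t ∈ Set.Icc 0 T, ∀ x, Φ t x ≤ A - c * ‖x‖) (hzero : ∀ x, Φ 0 x ≤ B)
    (hderiv : ∀ t ∈ Set.Ioc 0 T, ∀ x, (∀ y, Φ t y ≤ Φ t x) →
      ∃ a ≤ K, HasDerivWithinAt (fun τ => Φ τ x) a (Set.Iic t) t)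
    {t : ℝ} (ht : t ∈ Set.Icc 0 T) (x : X) : Φ t x ≤ B + K * t := by
  suffices hstrict : ∀ μ > 0, Φ t x ≤ B + (K + μ) * t by
    have htend : Tendsto (fun μ => B + (K + μ) * t) (𝓝[>] 0) (𝓝 (B + (K + 0) * t)) :=
      (Continuous.tendsto (by fun_prop) 0).mono_left nhdsWithin_le_nhds
    rw [add_zero] at htend
    exact ge_of_tendsto htend (eventually_mem_nhdsWithin.mono hstrict)
  intro μ hμ
  obtain ⟨τ, hτ, y, hmax⟩ := exists_isMaxOn_of_le_sub_mul_norm (A := A + |K + μ| * T)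
    (Φ := fun q : ℝ × X => Φ q.1 q.2 - (K + μ) * q.1) (ht.1.trans ht.2) hc
    (hΦ.sub (by fun_prop)) fun t ht x => by
      have htime : -(K + μ) * t ≤ |K + μ| * T :=
        mul_le_mul (neg_le_abs _) ht.2 ht.1 (abs_nonneg _)
      linarith [hdecay t ht x]
  have hle : ∀ t ∈ Set.Icc 0 T, ∀ x, Φ t x - (K + μ) * t ≤ Φ τ y - (K + μ) * τ :=
    fun t ht x => hmax (Set.mk_mem_prod ht (Set.mem_univ x))
  rcases hτ.1.eq_or_lt with rfl | hτpos
  · linarith [hle t ht x, hzero y]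
  · obtain ⟨a, haK, ha⟩ := hderiv τ ⟨hτpos, hτ.2⟩ y fun z => by linarith [hle τ hτ z]
    have hslope := hasDerivWithinAt_Iic_nonneg_of_max
      (ha.sub ((hasDerivWithinAt_id τ _).const_mul (K + μ))) hτpos fun σ hσ =>
        hle σ ⟨hσ.1.le, hσ.2.le.trans hτ.2⟩ y
    linarith

end Maximum

section Gradient

variable {X : Type*} [NormedAddCommGroup X] [InnerProductSpace ℝ X] [CompleteSpace X] {f : X → ℝ}

theorem gradient_eq_of_le_paraboloid {x p : X} {C : ℝ} (hf : DifferentiableAt ℝ f x)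
    (hfp : ∀ z, increment f x z ≤ ⟪p, z⟫ + C * ‖z‖ ^ 2) : gradient f x = p := by
  have hmax : IsLocalMax (fun y => f y - ⟪p, y⟫ - C * ‖y - x‖ ^ 2) x := by
    refine Eventually.of_forall fun y => ?_
    have htouch := hfp (y - x)
    rw [increment, add_sub_cancel, inner_sub_right] at htouch
    simp only [sub_self, norm_zero]
    linarith
  have hsq : HasFDerivAt (fun y => ‖y - x‖ ^ 2) (0 : X →L[ℝ] ℝ) x := by
    simpa using ((hasFDerivAt_id x).sub_const x).norm_sq
  have hzero := hmax.hasFDerivAt_eq_zero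
    ((hf.hasFDerivAt.sub (innerSL ℝ p).hasFDerivAt).sub (hsq.const_mul C))
  refine ext_inner_right ℝ fun z => ?_
  rw [inner_gradient_left]
  simpa [sub_eq_zero] using DFunLike.congr_fun hzero z

theorem gradient_neg (f : X → ℝ) (x : X) : gradient (-f) x = -gradient f x := by
  rw [gradient, fderiv_neg, map_neg, gradient]

theorem le_add_of_norm_gradient_le {L : ℝ} (hf : Differentiable ℝ f)
    (hL : ∀ x, ‖gradient f x‖ ≤ L) (x y : X) : f x ≤ f y + L * ‖x - y‖ := by
  have hmean := convex_univ.norm_image_sub_le_of_norm_fderiv_le (𝕜 := ℝ) (fun x _ => hf x)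
    (fun x _ => (LinearIsometryEquiv.norm_map _ _).symm.trans_le (hL x))
    (Set.mem_univ y) (Set.mem_univ x)
  linarith [le_abs_self (f x - f y), Real.norm_eq_abs (f x - f y)]

end Gradient

section PenalizedMax

variable {X : Type*} [NormedAddCommGroup X] {f g : X → ℝ} {η ε : ℝ} {x y : X}

/-- The pair `(x, y)` maximizes `f x + g y` minus the doubling penalty. -/
def IsPenalizedMax (η ε : ℝ) (f g : X → ℝ) (x y : X) : Prop :=
  ∀ x' y', f x' + g y' - doublingPenalty η ε x' y' ≤ f x + g y - doublingPenalty η ε x y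

theorem IsPenalizedMax.increment_add_increment_le (h : IsPenalizedMax η ε f g x y) (hε : 0 ≤ ε)
    (z : X) : increment f x z + increment g y z ≤ ε * ‖z‖ := by
  rw [increment, increment]
  linarith [h (x + z) (y + z), doublingPenalty_add_add_le (η := η) hε x y z]

variable [InnerProductSpace ℝ X]

theorem IsPenalizedMax.increment_left_le (h : IsPenalizedMax η ε f g x y) (hε : 0 ≤ ε) (z : X) :
    increment f x z ≤ ⟪η⁻¹ • (x - y) + ε • (japaneseBracket x)⁻¹ • x, z⟫ +
      (1 / (2 * η) + ε / 2) * ‖z‖ ^ 2 := by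
  rw [increment]
  linarith [h (x + z) y, doublingPenalty_add_left_le (η := η) hε x y z]

theorem IsPenalizedMax.increment_right_le (h : IsPenalizedMax η ε f g x y) (z : X) :
    increment g y z ≤ ⟪-(η⁻¹ • (x - y)), z⟫ + 1 / (2 * η) * ‖z‖ ^ 2 := by
  rw [increment]
  linarith [h x (y + z), doublingPenalty_add_right η ε x y z]

theorem IsPenalizedMax.exists_increment_le_paraboloid (h : IsPenalizedMax η ε f g x y)
    (hε0 : 0 ≤ ε) (hε1 : ε ≤ 1) :
    ∃ p q : X, (∀ z, increment f x z ≤ ⟪p, z⟫ + (1 / (2 * η) + 1 / 2) * ‖z‖ ^ 2) ∧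
      ∀ z, increment g y z ≤ ⟪q, z⟫ + (1 / (2 * η) + 1 / 2) * ‖z‖ ^ 2 := by
  refine ⟨η⁻¹ • (x - y) + ε • (japaneseBracket x)⁻¹ • x, -(η⁻¹ • (x - y)),
    fun z => (h.increment_left_le hε0 z).trans ?_, fun z => (h.increment_right_le z).trans ?_⟩
  · gcongr
  · gcongr
    exact le_add_of_nonneg_right one_half_pos.le

theorem IsPenalizedMax.abs_japaneseBracket_gradient_sub_le [CompleteSpace X]
    (h : IsPenalizedMax η ε f g x y) (hε : 0 ≤ ε) (hf : DifferentiableAt ℝ f x)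
    (hg : DifferentiableAt ℝ g y) :
    |japaneseBracket (gradient f x) - japaneseBracket (gradient g y)| ≤ ε := by
  rw [gradient_eq_of_le_paraboloid hf (h.increment_left_le hε),
    gradient_eq_of_le_paraboloid hg h.increment_right_le, japaneseBracket_neg]
  refine (abs_japaneseBracket_add_sub_le _ _).trans ?_
  rw [norm_smul, Real.norm_of_nonneg hε]
  exact mul_le_of_le_one_right hε (norm_inv_japaneseBracket_smul_le_one x)

end PenalizedMax

section GraphCurvature

variable {d : ℕ} {s L C : ℝ} {f : EuclideanSpace ℝ (Fin d) → ℝ}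

theorem exists_neg_le_graphCurvature_of_le_paraboloid (d : ℕ) (hs0 : 0 < s) (hs1 : s < 1)
    (hC : 0 ≤ C) :
    ∃ D : ℝ, 0 ≤ D ∧ ∀ (f : EuclideanSpace ℝ (Fin d) → ℝ) (x p : EuclideanSpace ℝ (Fin d)),
      Measurable f → (∃ h, HasFracMeanCurvature s (subgraph f) (graphPoint f x) h) →
      (∀ z, increment f x z ≤ ⟪p, z⟫ + C * ‖z‖ ^ 2) → -D ≤ graphCurvature s f x := by
  refine ⟨|s * (1 - s) * (∫ q in (Metric.ball (0 : GraphSpace d) 1)ᶜ, fracKernel s q) +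
    C * slabConstant (EuclideanSpace ℝ (Fin d)) s|, abs_nonneg _, fun f x p hf hcurv hfp => ?_⟩
  have hnear := truncatedGraphCurvature_sub_le_of_le_paraboloid hs0 hs1 one_pos hf hC
    (hasFracMeanCurvature_graphCurvature hcurv) hfp
  rw [Real.one_rpow, mul_one] at hnear
  have hfar := neg_le_of_abs_le
    (abs_truncatedFracMeanCurvature_le hs0 hs1 one_pos (subgraph f) (graphPoint f x))
  rw [← truncatedGraphCurvature] at hfar
  refine (neg_le_neg (le_abs_self _)).trans ?_
  linarith

theorem eventually_mul_rpow_le {θ μ : ℝ} (hθ : 0 < θ) (hμ : 0 < μ) (c : ℝ) :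
    ∀ᶠ r in 𝓝[>] (0 : ℝ), c * r ^ θ ≤ μ := by
  have htend : Tendsto (fun r : ℝ => c * r ^ θ) (𝓝 0) (𝓝 (c * 0 ^ θ)) :=
    ((Real.continuousAt_rpow_const 0 θ (Or.inr hθ.le)).const_mul c).tendsto
  rw [Real.zero_rpow hθ.ne', mul_zero] at htend
  exact (htend.mono_left nhdsWithin_le_nhds).eventually (ge_mem_nhds hμ)

/-- The curvature near the contact point is controlled by the paraboloids on a ball of radius `r`,
chosen so small that this contributes at most `μ`; the constant `N` depends on `r`. -/
theorem exists_neg_le_graphCurvature_add (d : ℕ) (hs0 : 0 < s) (hs1 : s < 1) (hC : 0 ≤ C) {μ : ℝ}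
    (hμ : 0 < μ) :
    ∃ N : ℝ, 0 ≤ N ∧ ∀ (f g : EuclideanSpace ℝ (Fin d) → ℝ)
      (x y p q : EuclideanSpace ℝ (Fin d)) (ε : ℝ), Measurable f → Measurable g →
      (∃ h, HasFracMeanCurvature s (subgraph f) (graphPoint f x) h) →
      (∃ h, HasFracMeanCurvature s (subgraph g) (graphPoint g y) h) →
      (∀ z, increment f x z ≤ ⟪p, z⟫ + C * ‖z‖ ^ 2) →
      (∀ z, increment g y z ≤ ⟪q, z⟫ + C * ‖z‖ ^ 2) → 0 ≤ ε →
      (∀ z, increment f x z + increment g y z ≤ ε * ‖z‖) →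
      -(μ + ε * N) ≤ graphCurvature s f x + graphCurvature s g y := by
  obtain ⟨r, hrμ, hr⟩ := ((eventually_mul_rpow_le (sub_pos.2 hs1) hμ
    (2 * (C * slabConstant (EuclideanSpace ℝ (Fin d)) s))).and self_mem_nhdsWithin).exists
  obtain ⟨N, hN, hsum⟩ := exists_neg_le_truncatedGraphCurvature_add d hs0 hs1 hr
  refine ⟨N, hN, fun f g x y p q ε hf hg hcf hcg hfp hgq hε hfg => ?_⟩
  have hnearf := truncatedGraphCurvature_sub_le_of_le_paraboloid hs0 hs1 hr hf hC
    (hasFracMeanCurvature_graphCurvature hcf) hfp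
  have hnearg := truncatedGraphCurvature_sub_le_of_le_paraboloid hs0 hs1 hr hg hC
    (hasFracMeanCurvature_graphCurvature hcg) hgq
  linarith [hsum f g x y ε hf hg hε hfg]

/-- The quantity `v H_s`: minus the vertical speed of the graph of `f` under the flow. -/
noncomputable def weightedCurvature (s : ℝ) (f : EuclideanSpace ℝ (Fin d) → ℝ)
    (x : EuclideanSpace ℝ (Fin d)) : ℝ :=
  areaFactor f x * graphCurvature s f x

theorem areaFactor_eq_japaneseBracket (f : EuclideanSpace ℝ (Fin d) → ℝ)
    (x : EuclideanSpace ℝ (Fin d)) : areaFactor f x = japaneseBracket (gradient f x) :=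
  rfl

/-- The time slices of the flow, without time: differentiable functions of slope at most `L` whose
graph has a fractional mean curvature everywhere. -/
structure IsAdmissibleGraph (s L : ℝ) (f : EuclideanSpace ℝ (Fin d) → ℝ) : Prop where
  differentiable : Differentiable ℝ f
  norm_gradient_le : ∀ x, ‖gradient f x‖ ≤ L
  hasCurvature : ∀ x, ∃ h, HasFracMeanCurvature s (subgraph f) (graphPoint f x) h

namespace IsAdmissibleGraph

theorem measurable (hf : IsAdmissibleGraph s L f) : Measurable f :=
  hf.differentiable.continuous.measurable

theorem nonneg (hf : IsAdmissibleGraph s L f) : 0 ≤ L :=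
  (norm_nonneg _).trans (hf.norm_gradient_le 0)

theorem le_add_mul_norm_sub (hf : IsAdmissibleGraph s L f) (x y : EuclideanSpace ℝ (Fin d)) :
    f x ≤ f y + L * ‖x - y‖ :=
  le_add_of_norm_gradient_le hf.differentiable hf.norm_gradient_le x y

theorem areaFactor_le (hf : IsAdmissibleGraph s L f) (x : EuclideanSpace ℝ (Fin d)) :
    areaFactor f x ≤ √(1 + L ^ 2) :=
  japaneseBracket_le_of_norm_le (hf.norm_gradient_le x)

theorem weightedCurvature_neg (hf : IsAdmissibleGraph s L f) (hs0 : 0 < s) (hs1 : s < 1)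
    (x : EuclideanSpace ℝ (Fin d)) : weightedCurvature s (-f) x = -weightedCurvature s f x := by
  have hcurv : graphCurvature s (-f) x = -graphCurvature s f x :=
    (hasFracMeanCurvature_subgraph_neg hs0 hs1 hf.measurable
      (hasFracMeanCurvature_graphCurvature (hf.hasCurvature x))).limUnder_eq
  rw [weightedCurvature, weightedCurvature, areaFactor_eq_japaneseBracket, gradient_neg,
    japaneseBracket_neg, hcurv, mul_neg, areaFactor_eq_japaneseBracket]

theorem neg (hf : IsAdmissibleGraph s L f) (hs0 : 0 < s) (hs1 : s < 1) :
    IsAdmissibleGraph s L (-f) where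
  differentiable := hf.differentiable.neg
  norm_gradient_le x := by
    rw [gradient_neg, norm_neg]
    exact hf.norm_gradient_le x
  hasCurvature x := (hf.hasCurvature x).imp' (- ·) fun _ =>
    hasFracMeanCurvature_subgraph_neg hs0 hs1 hf.measurable

theorem neg_mul_le_weightedCurvature (hf : IsAdmissibleGraph s L f) {D : ℝ} (hD : 0 ≤ D)
    {x : EuclideanSpace ℝ (Fin d)} (hcurv : -D ≤ graphCurvature s f x) :
    -(√(1 + L ^ 2) * D) ≤ weightedCurvature s f x := by
  have hspeed : areaFactor f x * -D ≤ weightedCurvature s f x :=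
    mul_le_mul_of_nonneg_left hcurv (Real.sqrt_nonneg _)
  linarith [mul_le_mul_of_nonneg_right (hf.areaFactor_le x) hD]

end IsAdmissibleGraph

/-- The barrier `κ⟨·⟩` touching the graph from above can be replaced by a fixed paraboloid. -/
theorem exists_neg_le_weightedCurvature_of_le_barrier (d : ℕ) (hs0 : 0 < s) (hs1 : s < 1) (L : ℝ)
    {κ : ℝ} (hκ : 0 ≤ κ) :
    ∃ D : ℝ, ∀ f : EuclideanSpace ℝ (Fin d) → ℝ, IsAdmissibleGraph s L f → ∀ x z,
      (∀ y, f (x + y) - κ * japaneseBracket y ≤ f (x + z) - κ * japaneseBracket z) →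
      -D ≤ weightedCurvature s f (x + z) := by
  obtain ⟨D, hD, hlower⟩ := exists_neg_le_graphCurvature_of_le_paraboloid d hs0 hs1
    (C := κ / 2) (by positivity)
  refine ⟨√(1 + L ^ 2) * D, fun f hf x z hmax => hf.neg_mul_le_weightedCurvature hD <|
    hlower f (x + z) (κ • (japaneseBracket z)⁻¹ • z) hf.measurable (hf.hasCurvature _)
      fun y => ?_⟩
  have hbracket := mul_le_mul_of_nonneg_left (japaneseBracket_add_le_add_inner z y) hκ
  rw [increment, real_inner_smul_left, add_assoc]
  linarith [hmax (z + y)]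

theorem neg_le_mul_add_mul {v w a b V D e ε : ℝ} (hv : 0 ≤ v) (hw : 0 ≤ w) (hvV : v ≤ V)
    (hwV : w ≤ V) (hvw : |v - w| ≤ ε) (hD : 0 ≤ D) (ha : -D ≤ a) (hb : -D ≤ b) (he : 0 ≤ e)
    (hab : -e ≤ a + b) : -(ε * D + V * e) ≤ v * a + w * b := by
  wlog hle : w ≤ v generalizing v w a b
  · rw [add_comm (v * a)]
    exact this hw hv hwV hvV (by rwa [abs_sub_comm]) hb ha (by rwa [add_comm])
      (le_of_not_ge hle)
  have hdiff : (v - w) * -D ≤ (v - w) * a := mul_le_mul_of_nonneg_left ha (sub_nonneg.2 hle)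
  have hsum : w * -e ≤ w * (a + b) := mul_le_mul_of_nonneg_left hab hw
  have hDε : (v - w) * D ≤ ε * D := mul_le_mul_of_nonneg_right ((le_abs_self _).trans hvw) hD
  have heV : w * e ≤ V * e := mul_le_mul_of_nonneg_right hwV he
  linarith

theorem eventually_neg_le_weightedCurvature_add (d : ℕ) (hs0 : 0 < s) (hs1 : s < 1) (L : ℝ)
    {η μ : ℝ} (hη : 0 < η) (hμ : 0 < μ) :
    ∀ᶠ ε in 𝓝[>] (0 : ℝ), ∀ f g : EuclideanSpace ℝ (Fin d) → ℝ, IsAdmissibleGraph s L f →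
      IsAdmissibleGraph s L g → ∀ x y, IsPenalizedMax η ε f g x y →
      -μ ≤ weightedCurvature s f x + weightedCurvature s g y := by
  set V : ℝ := √(1 + L ^ 2)
  have hV : 0 < V := by positivity
  have hC : 0 ≤ 1 / (2 * η) + 1 / 2 := by positivity
  obtain ⟨D, hD, hlower⟩ := exists_neg_le_graphCurvature_of_le_paraboloid d hs0 hs1 hC
  obtain ⟨N, hN, hsum⟩ := exists_neg_le_graphCurvature_add d hs0 hs1 hC (μ := μ / (2 * V))
    (by positivity)
  have hsmall : ∀ᶠ ε in 𝓝[>] (0 : ℝ), ε * D + V * (μ / (2 * V) + ε * N) < μ := by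
    have htend : Tendsto (fun ε => ε * D + V * (μ / (2 * V) + ε * N)) (𝓝[>] 0)
        (𝓝 (0 * D + V * (μ / (2 * V) + 0 * N))) :=
      (Continuous.tendsto (by fun_prop) 0).mono_left nhdsWithin_le_nhds
    have hhalf : V * (μ / (2 * V)) = μ / 2 := by field_simp
    exact htend.eventually (gt_mem_nhds (by linarith))
  filter_upwards [hsmall, Ioo_mem_nhdsGT one_pos] with ε hεμ ⟨hε0, hε1⟩ f g hf hg x y hmax
  obtain ⟨p, q, hfp, hgq⟩ := hmax.exists_increment_le_paraboloid hε0.le hε1.le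
  refine (neg_le_neg hεμ.le).trans (neg_le_mul_add_mul (Real.sqrt_nonneg _) (Real.sqrt_nonneg _)
    (hf.areaFactor_le x) (hg.areaFactor_le y) ?_ hD ?_ ?_ (by positivity) ?_)
  · exact hmax.abs_japaneseBracket_gradient_sub_le hε0.le (hf.differentiable x)
      (hg.differentiable y)
  · exact hlower f x p hf.measurable (hf.hasCurvature x) hfp
  · exact hlower g y q hg.measurable (hg.hasCurvature y) hgq
  · exact hsum f g x y p q ε hf.measurable hg.measurable (hf.hasCurvature x) (hg.hasCurvature y)
      hfp hgq hε0.le (hmax.increment_add_increment_le hε0.le)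

end GraphCurvature

section Subsolution

variable {d : ℕ} {s L T M M₁ M₂ m : ℝ} {u w : ℝ → EuclideanSpace ℝ (Fin d) → ℝ}

/-- A subsolution on `[0, T]` of the flow with constant forcing, `∂ₜu ≤ M - v H_s`, all of whose
time slices are admissible. Only the time derivative from the left is required to exist, so that the
final time is not exceptional. -/
structure IsSubsolution (s L T M : ℝ) (u : ℝ → EuclideanSpace ℝ (Fin d) → ℝ) : Prop where
  continuousOn : ContinuousOn (fun q : ℝ × EuclideanSpace ℝ (Fin d) => u q.1 q.2)
    (Set.Icc 0 T ×ˢ Set.univ)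
  admissible : ∀ t ∈ Set.Icc 0 T, IsAdmissibleGraph s L (u t)
  exists_deriv_le : ∀ t ∈ Set.Ioc 0 T, ∀ x, ∃ a ≤ M - weightedCurvature s (u t) x,
    HasDerivWithinAt (fun τ => u τ x) a (Set.Iic t) t

theorem IsAdmissibleGraph.isSubsolution_const {f : EuclideanSpace ℝ (Fin d) → ℝ}
    (hf : IsAdmissibleGraph s L f) (hM : ∀ x, weightedCurvature s f x ≤ M) (T : ℝ) :
    IsSubsolution s L T M fun _ => f where
  continuousOn := (hf.differentiable.continuous.comp continuous_snd).continuousOn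
  admissible _ _ := hf
  exists_deriv_le t _ x := ⟨0, sub_nonneg.2 (hM x), hasDerivWithinAt_const t _ (f x)⟩

namespace IsSubsolution

/-- The barrier `(L + 1)⟨· - x⟩` outgrows `u`, so it touches `u` from above somewhere, and there the
speed of `u` is bounded. -/
theorem exists_le_add (hs0 : 0 < s) (hs1 : s < 1) (hT : 0 ≤ T) (hu : IsSubsolution s L T M u) :
    ∃ K, ∀ t ∈ Set.Icc 0 T, ∀ x, u t x ≤ u 0 x + K := by
  have hzero : (0 : ℝ) ∈ Set.Icc 0 T := ⟨le_rfl, hT⟩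
  have hL : 0 ≤ L + 1 := add_nonneg (hu.admissible 0 hzero).nonneg zero_le_one
  obtain ⟨D, hspeed⟩ := exists_neg_le_weightedCurvature_of_le_barrier d hs0 hs1 L hL
  refine ⟨L + 1 + |M + D| * T, fun t ht x => ?_⟩
  have hcone : ∀ τ ∈ Set.Icc 0 T, ∀ z,
      u τ (x + z) - (L + 1) * japaneseBracket z ≤ u τ x - 1 * ‖z‖ := fun τ hτ z => by
    have hlip := (hu.admissible τ hτ).le_add_mul_norm_sub (x + z) x
    rw [add_sub_cancel_left] at hlip
    linarith [mul_le_mul_of_nonneg_left (norm_le_japaneseBracket z) hL]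
  obtain ⟨A, hA⟩ : BddAbove ((u · x) '' Set.Icc 0 T) := isCompact_Icc.bddAbove_image
    (hu.continuousOn.comp (f := fun τ : ℝ => (τ, x)) (by fun_prop) fun τ hτ => ⟨hτ, Set.mem_univ _⟩)
  have hbarrier := le_add_mul_of_deriv_le_at_max (A := A) (B := u 0 x) (K := |M + D|)
    (Φ := fun τ z => u τ (x + z) - (L + 1) * japaneseBracket z)
    one_pos ((hu.continuousOn.comp (f := fun q : ℝ × EuclideanSpace ℝ (Fin d) => (q.1, x + q.2))
      (by fun_prop) fun q hq => ⟨hq.1, Set.mem_univ _⟩).sub (by fun_prop))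
    (fun τ hτ z => by linarith [hcone τ hτ z, hA (Set.mem_image_of_mem _ hτ)])
    (fun z => by linarith [hcone 0 hzero z, norm_nonneg z])
    (fun τ hτ z hmax => ?_) ht 0
  · simp only [add_zero, japaneseBracket_zero] at hbarrier
    linarith [mul_le_mul_of_nonneg_left ht.2 (abs_nonneg (M + D))]
  · obtain ⟨a, ha, hderiv⟩ := hu.exists_deriv_le τ hτ (x + z)
    refine ⟨a, ?_, hderiv.sub_const _⟩
    linarith [hspeed (u τ) (hu.admissible τ ⟨hτ.1.le, hτ.2⟩) x z hmax, le_abs_self (M + D)]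

theorem eventually_add_sub_doublingPenalty_le (hs0 : 0 < s) (hs1 : s < 1)
    (hu : IsSubsolution s L T M₁ u) (hw : IsSubsolution s L T M₂ w)
    (hzero : ∀ x, u 0 x + w 0 x ≤ m) {η μ : ℝ} (hη : 0 < η) (hμ : 0 < μ) :
    ∀ᶠ ε in 𝓝[>] (0 : ℝ), ∀ t ∈ Set.Icc 0 T, ∀ x y,
      u t x + w t y - doublingPenalty η ε x y ≤
        m + L ^ 2 * η / 2 + (M₁ + M₂ + μ) * t := by
  filter_upwards [eventually_neg_le_weightedCurvature_add d hs0 hs1 L hη hμ, self_mem_nhdsWithin]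
    with ε hspeed (hε : 0 < ε) t ht x y
  have hT := ht.1.trans ht.2
  obtain ⟨K₁, hK₁⟩ := hu.exists_le_add hs0 hs1 hT
  obtain ⟨K₂, hK₂⟩ := hw.exists_le_add hs0 hs1 hT
  have hcont : ContinuousOn (fun q : ℝ × EuclideanSpace ℝ (Fin d) × EuclideanSpace ℝ (Fin d) =>
      u q.1 q.2.1 + w q.1 q.2.2 - doublingPenalty η ε q.2.1 q.2.2) (Set.Icc 0 T ×ˢ Set.univ) := by
    have hmaps : ∀ x : ℝ × EuclideanSpace ℝ (Fin d) × EuclideanSpace ℝ (Fin d) →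
        EuclideanSpace ℝ (Fin d), Set.MapsTo (fun q => (q.1, x q)) (Set.Icc 0 T ×ˢ Set.univ)
          (Set.Icc 0 T ×ˢ Set.univ) := fun x q hq => ⟨hq.1, Set.mem_univ _⟩
    exact ((hu.continuousOn.comp (by fun_prop) (hmaps fun q => q.2.1)).add
      (hw.continuousOn.comp (by fun_prop) (hmaps fun q => q.2.2))).sub (by fun_prop)
  refine le_add_mul_of_deriv_le_at_max (Φ := fun t q => u t q.1 + w t q.2 -
      doublingPenalty η ε q.1 q.2) (A := m + K₁ + K₂ + (L + ε) ^ 2 * η / 2) hε hcont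
    (fun τ hτ q => ?_) (fun q => ?_) (fun τ hτ q hmax => ?_) ht (x, y)
  · have hlip := (hw.admissible τ hτ).le_add_mul_norm_sub q.2 q.1
    rw [norm_sub_rev] at hlip
    linarith [hzero q.1, hK₁ τ hτ q.1, hK₂ τ hτ q.1,
      mul_norm_sub_sub_doublingPenalty_le_sub_norm hη hε.le L q]
  · have hlip := (hw.admissible 0 ⟨le_rfl, hT⟩).le_add_mul_norm_sub q.2 q.1
    rw [norm_sub_rev] at hlip
    linarith [hzero q.1, mul_norm_sub_sub_doublingPenalty_le hη hε.le L q.1 q.2]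
  · obtain ⟨a, ha, hua⟩ := hu.exists_deriv_le τ hτ q.1
    obtain ⟨b, hb, hwb⟩ := hw.exists_deriv_le τ hτ q.2
    have hsum := hspeed (u τ) (w τ) (hu.admissible τ ⟨hτ.1.le, hτ.2⟩)
      (hw.admissible τ ⟨hτ.1.le, hτ.2⟩) q.1 q.2 fun x' y' => hmax (x', y')
    exact ⟨a + b, by linarith, (hua.add hwb).sub_const _⟩

/-- The comparison principle, for `u` and `-w`. -/
theorem add_le (hs0 : 0 < s) (hs1 : s < 1) (hu : IsSubsolution s L T M₁ u)
    (hw : IsSubsolution s L T M₂ w) (hzero : ∀ x, u 0 x + w 0 x ≤ m) {t : ℝ}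
    (ht : t ∈ Set.Icc 0 T) (x : EuclideanSpace ℝ (Fin d)) :
    u t x + w t x ≤ m + (M₁ + M₂) * t := by
  have hpenalized : ∀ η > 0, u t x + w t x ≤ m + L ^ 2 * η / 2 + (M₁ + M₂ + η) * t := by
    intro η hη
    have htend : Tendsto (fun ε => u t x + w t x - ε * japaneseBracket x) (𝓝[>] 0)
        (𝓝 (u t x + w t x - 0 * japaneseBracket x)) :=
      (Continuous.tendsto (by fun_prop) 0).mono_left nhdsWithin_le_nhds
    rw [zero_mul, sub_zero] at htend
    refine le_of_tendsto htend ?_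
    filter_upwards [hu.eventually_add_sub_doublingPenalty_le hs0 hs1 hw hzero hη hη] with ε hle
    simpa only [doublingPenalty_self] using hle t ht x x
  have htend : Tendsto (fun η => m + L ^ 2 * η / 2 + (M₁ + M₂ + η) * t) (𝓝[>] 0)
      (𝓝 (m + L ^ 2 * 0 / 2 + (M₁ + M₂ + 0) * t)) :=
    (Continuous.tendsto (by fun_prop) 0).mono_left nhdsWithin_le_nhds
  simp only [mul_zero, zero_div, add_zero] at htend
  exact ge_of_tendsto htend (eventually_mem_nhdsWithin.mono hpenalized)

end IsSubsolution

end Subsolution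

section Flow

variable {d : ℕ} {s L T M : ℝ} {u : ℝ → EuclideanSpace ℝ (Fin d) → ℝ}

/-- A graphical flow on the closed interval `[0, T]`, of slope at most `L`, under the regularity
that the comparison principle needs: the slices are differentiable in space, and differentiable in
time from the left. -/
structure IsAdmissibleFlow (s L T : ℝ) (u : ℝ → EuclideanSpace ℝ (Fin d) → ℝ) : Prop where
  continuousOn : ContinuousOn (fun q : ℝ × EuclideanSpace ℝ (Fin d) => u q.1 q.2)
    (Set.Icc 0 T ×ˢ Set.univ)
  admissible : ∀ t ∈ Set.Icc 0 T, IsAdmissibleGraph s L (u t)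
  evolution : ∀ t ∈ Set.Ioc 0 T, ∀ x,
    HasDerivWithinAt (fun τ => u τ x) (-weightedCurvature s (u t) x) (Set.Iic t) t

namespace IsAdmissibleFlow

theorem isSubsolution (hu : IsAdmissibleFlow s L T u) : IsSubsolution s L T 0 u where
  continuousOn := hu.continuousOn
  admissible := hu.admissible
  exists_deriv_le t ht x := ⟨_, (zero_sub _).ge, hu.evolution t ht x⟩

theorem neg (hs0 : 0 < s) (hs1 : s < 1) (hu : IsAdmissibleFlow s L T u) :
    IsAdmissibleFlow s L T (-u) where
  continuousOn := hu.continuousOn.neg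
  admissible t ht := (hu.admissible t ht).neg hs0 hs1
  evolution t ht x := by
    rw [Pi.neg_apply, (hu.admissible t ⟨ht.1.le, ht.2⟩).weightedCurvature_neg hs0 hs1]
    exact (hu.evolution t ht x).neg

theorem mono {T' : ℝ} (hu : IsAdmissibleFlow s L T u) (hT : T' ≤ T) :
    IsAdmissibleFlow s L T' u where
  continuousOn := hu.continuousOn.mono (Set.prod_mono_left (Set.Icc_subset_Icc_right hT))
  admissible t ht := hu.admissible t ⟨ht.1, ht.2.trans hT⟩
  evolution t ht := hu.evolution t ⟨ht.1, ht.2.trans hT⟩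

theorem shift (hu : IsAdmissibleFlow s L T u) {h : ℝ} (hh : 0 ≤ h) :
    IsAdmissibleFlow s L (T - h) fun t => u (t + h) := by
  have hIcc : ∀ t ∈ Set.Icc 0 (T - h), t + h ∈ Set.Icc 0 T := fun t ht =>
    ⟨add_nonneg ht.1 hh, le_sub_iff_add_le.1 ht.2⟩
  refine ⟨?_, fun t ht => hu.admissible _ (hIcc t ht), fun t ht x => ?_⟩
  · have hshift : Continuous fun q : ℝ × EuclideanSpace ℝ (Fin d) => (q.1 + h, q.2) := by fun_prop
    exact hu.continuousOn.comp hshift.continuousOn fun q hq => ⟨hIcc _ hq.1, Set.mem_univ _⟩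
  · have hderiv := hu.evolution (t + h)
      ⟨add_pos_of_pos_of_nonneg ht.1 hh, le_sub_iff_add_le.1 ht.2⟩ x
    have htime : HasDerivWithinAt (fun τ : ℝ => τ + h) 1 (Set.Iic t) t :=
      (hasDerivWithinAt_id t _).add_const h
    have hcomp := HasDerivWithinAt.comp t hderiv htime fun τ (hτ : τ ≤ t) =>
      add_le_add_left hτ h
    rwa [mul_one] at hcomp

theorem sub_le_mul (hs0 : 0 < s) (hs1 : s < 1) (hu : IsAdmissibleFlow s L T u)
    (hM : ∀ x, weightedCurvature s (u 0) x ≤ M) {t : ℝ} (ht : t ∈ Set.Icc 0 T)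
    (x : EuclideanSpace ℝ (Fin d)) : u 0 x - u t x ≤ M * t := by
  have hstationary := (hu.admissible 0 ⟨le_rfl, ht.1.trans ht.2⟩).isSubsolution_const hM T
  have hle := hstationary.add_le hs0 hs1 (hu.neg hs0 hs1).isSubsolution (m := 0)
    (fun y => (add_neg_cancel _).le) ht x
  simpa [sub_eq_add_neg] using hle

theorem sub_shift_le_mul (hs0 : 0 < s) (hs1 : s < 1) (hu : IsAdmissibleFlow s L T u)
    (hM : ∀ x, weightedCurvature s (u 0) x ≤ M) {t h : ℝ} (ht : 0 ≤ t) (hh : 0 ≤ h)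
    (hth : t + h ≤ T) (x : EuclideanSpace ℝ (Fin d)) : u t x - u (t + h) x ≤ M * h := by
  have hle := (hu.mono (sub_le_self T hh)).isSubsolution.add_le hs0 hs1
    ((hu.shift hh).neg hs0 hs1).isSubsolution (m := M * h) (fun y => ?_)
    ⟨ht, le_sub_iff_add_le.2 hth⟩ x
  · simpa [sub_eq_add_neg] using hle
  · simpa [sub_eq_add_neg] using hu.sub_le_mul hs0 hs1 hM ⟨hh, by linarith⟩ y

theorem weightedCurvature_le (hs0 : 0 < s) (hs1 : s < 1) (hu : IsAdmissibleFlow s L T u)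
    (hM : ∀ x, weightedCurvature s (u 0) x ≤ M) {t : ℝ} (ht : t ∈ Set.Icc 0 T)
    (x : EuclideanSpace ℝ (Fin d)) : weightedCurvature s (u t) x ≤ M := by
  rcases ht.1.eq_or_lt with rfl | hpos
  · exact hM x
  have hslope := (hasDerivWithinAt_iff_tendsto_slope' Set.self_notMem_Iio).1
    (hu.evolution t ⟨hpos, ht.2⟩ x).Iio_of_Iic
  refine neg_le_neg_iff.1 (ge_of_tendsto hslope ?_)
  filter_upwards [Ioo_mem_nhdsLT hpos] with τ hτ
  have hle := hu.sub_shift_le_mul hs0 hs1 hM hτ.1.le (sub_nonneg.2 hτ.2.le)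
    (by linarith [ht.2]) x
  rw [add_sub_cancel] at hle
  rw [slope_def_field, le_div_iff_of_neg (sub_neg.2 hτ.2)]
  linarith

end IsAdmissibleFlow

theorem IsGraphicalFlow.differentiable {T : EReal} (hu : IsGraphicalFlow s T u) {t : ℝ}
    (ht : 0 ≤ t) (htT : (t : EReal) < T) : Differentiable ℝ (u t) := by
  rcases ht.eq_or_lt with rfl | hpos
  · exact hu.contDiff_zero.differentiable one_ne_zero
  · have hopen : IsOpen {q : ℝ × EuclideanSpace ℝ (Fin d) | 0 < q.1 ∧ (q.1 : EReal) < T} :=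
      (isOpen_lt continuous_const continuous_fst).inter
        (isOpen_lt (continuous_coe_real_ereal.comp continuous_fst) continuous_const)
    intro x
    have hdiff := (hu.contDiffOn.contDiffAt
      (hopen.mem_nhds (x := (t, x)) ⟨hpos, htT⟩)).differentiableAt two_ne_zero
    exact hdiff.comp (f := fun y : EuclideanSpace ℝ (Fin d) => (t, y)) x (by fun_prop)

theorem IsGraphicalFlow.isAdmissibleFlow {T' : EReal} (hu : IsGraphicalFlow s T' u)
    (hL : ∀ t : ℝ, 0 ≤ t → (t : EReal) < T' → ∀ x, ‖gradient (u t) x‖ ≤ L)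
    (hT : (T : EReal) < T') : IsAdmissibleFlow s L T u := by
  have hlt : ∀ t ≤ T, (t : EReal) < T' := fun t ht => (EReal.coe_le_coe_iff.2 ht).trans_lt hT
  exact
    { continuousOn := hu.continuousOn.mono fun q hq => ⟨hq.1.1, hlt _ hq.1.2⟩
      admissible := fun t ht => ⟨hu.differentiable ht.1 (hlt t ht.2), hL t ht.1 (hlt t ht.2),
        hu.hasCurvature t ht.1 (hlt t ht.2)⟩
      evolution := fun t ht x => (hu.evolution t ht.1 (hlt t ht.2) x).hasDerivWithinAt }

end Flow

theorem mainTheorem11_general {d : ℕ} {s L T : ℝ} (hs0 : 0 < s) (hs1 : s < 1)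
    {u : ℝ → EuclideanSpace ℝ (Fin d) → ℝ} (hu : IsAdmissibleFlow s L T u) (M : ℝ) :
    ((∀ x, weightedCurvature s (u 0) x ≤ M) →
      ∀ t ∈ Set.Icc 0 T, ∀ x, weightedCurvature s (u t) x ≤ M) ∧
    ((∀ x, M ≤ weightedCurvature s (u 0) x) →
      ∀ t ∈ Set.Icc 0 T, ∀ x, M ≤ weightedCurvature s (u t) x) := by
  refine ⟨fun hM t ht x => hu.weightedCurvature_le hs0 hs1 hM ht x, fun hM t ht x => ?_⟩
  have hneg : ∀ τ ∈ Set.Icc 0 T, ∀ y,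
      weightedCurvature s (-u τ) y = -weightedCurvature s (u τ) y := fun τ hτ =>
    (hu.admissible τ hτ).weightedCurvature_neg hs0 hs1
  rw [← neg_le_neg_iff, ← hneg t ht]
  refine (hu.neg hs0 hs1).weightedCurvature_le hs0 hs1 (fun y => ?_) ht x
  rw [Pi.neg_apply, hneg 0 ⟨le_rfl, ht.1.trans ht.2⟩]
  exact neg_le_neg (hM y)

theorem mainTheorem11 {d : ℕ} (s : ℝ) (hs0 : 0 < s) (hs1 : s < 1) (T : EReal) (hT : 0 < T)
    (u : ℝ → EuclideanSpace ℝ (Fin d) → ℝ) (hu : IsGraphicalFlow s T u)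
    (L : ℝ) (hL : ∀ t : ℝ, 0 ≤ t → (t : EReal) < T → ∀ x, ‖gradient (u t) x‖ ≤ L)
    (M : ℝ) (hM : ∀ x, |areaFactor (u 0) x * graphCurvature s (u 0) x| ≤ M) :
    ∀ t : ℝ, 0 ≤ t → (t : EReal) < T → ∀ x,
      |areaFactor (u t) x * graphCurvature s (u t) x| ≤ M := by
  intro t ht htT x
  have hflow := hu.isAdmissibleFlow hL htT
  exact abs_le.2
    ⟨(mainTheorem11_general hs0 hs1 hflow (-M)).2 (fun y => (abs_le.1 (hM y)).1) t ⟨ht, le_rfl⟩ x,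
      (mainTheorem11_general hs0 hs1 hflow M).1 (fun y => (abs_le.1 (hM y)).2) t ⟨ht, le_rfl⟩ x⟩
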